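/- Let $q$ be an odd prime power of the form $q=2am+1$ with positive integers $a,m$, let $p$ be the prime dividing $q$, and let $\zeta_p\in\mathbb{C}$ be a primitive $p$-th root of unity. For $n\ge 1$ let $\mathbb{C}^{q^n}\cong(\mathbb{C}^q)^{\otimes n}$ carry the orthonormal basis $\{|x\rangle : x\in\mathbb{F}_q^n\}$. For $0\le l\le p-1$ and $u,b\in\mathbb{F}_q^n$, the error $e=\zeta_p^lT^uR^b$ is the linear operator given by $$e|x\rangle=\zeta_p^{\,l+\mathrm{Tr}_{\mathbb{F}_q/\mathbb{F}_p}(\sum_i b_ix_i)}|x+u\rangle ,$$ and its quantum weight is the number of $i$ with $(u_i,b_i)\neq(0,0)$. A subspace $Q\subseteq\mathbb{C}^{q^n}$ with orthogonal projection $P$ detects $e$ if $PeP=cP$ for some $c\in\mathbb{C}$. A $q$-ary $[[n,k,d]]$ quantum code is a $q^k$-dimensional subspace $Q\subseteq\mathbb{C}^{q^n}$ of minimum distance $d$, i.e. $Q$ detects all errors of quantum weight less than $d$ but fails to detect some error of quantum weight $d$. It is a quantum MDS code if it attains the quantum Singleton bound, $2d=n-k+2$. Then for every integer $d$ with $2\le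 d\le(a+1)m+1$ there exists a $q$-ary $$\left[\left[\tfrac{q^2-1}{a},\ \tfrac{q^2-1}{a}-2d+2,\ d\right]\right]$$ quantum MDS code. -/

import Mathlib

/-- The state space `(ℂ^q)^{⊗ n} ≅ ℂ^(q^n)`: the Hilbert space with orthonormal basis
`|x⟩` indexed by `x ∈ F^n`, where `F` is the field with `q` elements. -/
abbrev QState (F : Type*) [Fintype F] (n : ℕ) : Type _ :=
  EuclideanSpace ℂ (Fin n → F)

/-- An element `ζ^l T^a R^b` of the error group, `0 ≤ l ≤ p - 1`, `a, b ∈ F^n`. -/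
structure QError (F : Type*) (p n : ℕ) where
  /-- the exponent `l` of the global phase -/
  phase : Fin p
  /-- the shift vector `a` -/
  shift : Fin n → F
  /-- the vector `b` of the phase operators -/
  clock : Fin n → F

namespace QError

variable {F : Type*} [Field F] {p n : ℕ}

/-- The quantum weight: the number of positions `i` with `(a_i, b_i) ≠ (0, 0)`. -/
noncomputable def weight (e : QError F p n) : ℕ :=
  Set.ncard {i : Fin n | (e.shift i, e.clock i) ≠ (0, 0)}

/-- The scalar `ζ^(l + Tr(b · x))` by which the error acts on the basis vector `|x⟩`,
where `Tr` is the trace from `F` to its prime field. -/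
noncomputable def coeff [Algebra (ZMod p) F] (ζ : ℂ) (e : QError F p n) (x : Fin n → F) : ℂ :=
  ζ ^ ((e.phase : ℕ) + (Algebra.trace (ZMod p) F (∑ i, e.clock i * x i)).val)

/-- The linear operator of an error: `ζ^l T^a R^b |x⟩ = ζ^(l + Tr(b · x)) |x + a⟩`
(see `QError.op_single`), written in coordinates. -/
noncomputable def op [Fintype F] [Algebra (ZMod p) F] (ζ : ℂ) (e : QError F p n) :
    QState F n →ₗ[ℂ] QState F n where
  toFun v := WithLp.toLp 2 fun y => e.coeff ζ (y - e.shift) * v (y - e.shift)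
  map_add' v w := by
    ext y
    simp [mul_add]
  map_smul' c v := by
    ext y
    simp [mul_left_comm]

theorem op_single [Fintype F] [DecidableEq F] [Algebra (ZMod p) F] (ζ : ℂ)
    (e : QError F p n) (x : Fin n → F) :
    e.op ζ (EuclideanSpace.single x (1 : ℂ)) =
      e.coeff ζ x • EuclideanSpace.single (x + e.shift) (1 : ℂ) := by
  ext y
  by_cases h : y = x + e.shift
  · subst h
    simp [op]
  · have h2 : y - e.shift ≠ x := fun h3 => h (by rw [← h3]; abel)
    simp [op, h, h2]

end QError

section QuantumCodes

variable {F : Type*} [Field F] [Fintype F] {p n : ℕ} [Algebra (ZMod p) F]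

/-- The code `Q` detects the error `e`: `P e P = c P` for some scalar `c`, where `P` is the
orthogonal projection onto `Q`. -/
def QDetects (ζ : ℂ) (Q : Submodule ℂ (QState F n)) (e : QError F p n) : Prop :=
  ∃ c : ℂ, ∀ v ∈ Q, ∀ w ∈ Q, inner ℂ v (e.op ζ w) = c * inner ℂ v w

/-- `Q` has minimum distance `d`: it detects all errors of quantum weight less than `d`, but fails
to detect some error of quantum weight `d`. -/
def HasQMinDist (p : ℕ) [Algebra (ZMod p) F] (ζ : ℂ) (Q : Submodule ℂ (QState F n))
    (d : ℕ) : Prop :=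
  (∀ e : QError F p n, e.weight < d → QDetects ζ Q e) ∧
    ∃ e : QError F p n, e.weight = d ∧ ¬ QDetects ζ Q e

/-- `Q` is an `[[n, k, d]]_q` quantum code, `q = #F`: it has dimension `q^k` and minimum
distance `d`. -/
def IsQCode (p : ℕ) [Algebra (ZMod p) F] (ζ : ℂ) (Q : Submodule ℂ (QState F n))
    (k d : ℕ) : Prop :=
  Module.finrank ℂ Q = Fintype.card F ^ k ∧ HasQMinDist p ζ Q d

/-- `Q` is an `[[n, k, d]]_q` quantum MDS code: an `[[n, k, d]]_q` code which attains the quantum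
Singleton bound `2d ≤ n - k + 2`. -/
def IsQMDSCode (p : ℕ) [Algebra (ZMod p) F] (ζ : ℂ) (Q : Submodule ℂ (QState F n))
    (k d : ℕ) : Prop :=
  IsQCode p ζ Q k d ∧ 2 * (d : ℤ) = (n : ℤ) - (k : ℤ) + 2

end QuantumCodes

/-! Put `K = 𝔽_{q²}` and `n = 2m(q+1) = (q²-1)/a`. The code comes from a generalized Reed–Solomon
code `C ⊆ K^n` of dimension `d-1` evaluated at the `n`-th roots of unity, through the Hermitian
stabilizer construction.

Quantum side: for `S ⊆ F^n × F^n` isotropic for the symplectic form, the common fixed space of its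
Weyl operators has dimension `q^n / |S|` and misses exactly the errors in `S^⊥ \ S`
(`qDetects_iff`). Writing `K = F ⊕ Fω`, the symplectic form is the `ω`-coordinate of the Hermitian
form, so a Hermitian self-orthogonal `C` gives such an `S`, with minimum distance the least weight
in `C^⊥ \ C`. For Reed–Solomon codes, Vandermonde determinants show this to be `d`.

Classical side: self-orthogonality asks for multipliers with `∑ v_s^{q+1} x_s^{i+qj} = 0`. Any
nonzero elements of `F` may serve as the `v_s^{q+1}`, the norm being surjective. Traces `c x^{2E} +
(c x^{2E})^q` are chosen: the even exponent lets one `c` keep them all nonzero, and the sums then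
vanish because `n` divides none of the exponents (`not_dvd_exponent`). -/

open scoped Matrix ComplexConjugate

/-! ### Weyl operators and stabilizer codes -/

section Stabilizer

variable {F : Type*} [Field F] [Fintype F] {n : ℕ}

/-- The alternating form `⟨b_s, u_t⟩ - ⟨b_t, u_s⟩` on `F^n × F^n`. -/
def symplecticForm (s t : (Fin n → F) × (Fin n → F)) : F := s.2 ⬝ᵥ t.1 - t.2 ⬝ᵥ s.1

omit [Fintype F] in
theorem symplecticForm_smul_left (c : F) (s t : (Fin n → F) × (Fin n → F)) :
    symplecticForm (c • s) t = c * symplecticForm s t := by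
  simp [symplecticForm, mul_sub]

omit [Fintype F] in
theorem symplecticForm_swap (s t : (Fin n → F) × (Fin n → F)) :
    symplecticForm s t = -symplecticForm t s := by
  simp [symplecticForm]

/-- The Weyl operator of `(u, b)`: `|x⟩ ↦ χ (b · x + b · u / 2) |x + u⟩`. -/
noncomputable def weyl (χ : AddChar F ℂ) (s : (Fin n → F) × (Fin n → F)) :
    QState F n →ₗ[ℂ] QState F n where
  toFun v := WithLp.toLp 2 fun y => χ (s.2 ⬝ᵥ y - s.2 ⬝ᵥ s.1 / 2) * v (y - s.1)
  map_add' v w := by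
    ext y
    simp [mul_add]
  map_smul' c v := by
    ext y
    simp [mul_left_comm]

theorem weyl_apply (χ : AddChar F ℂ) (s : (Fin n → F) × (Fin n → F)) (v : QState F n)
    (y : Fin n → F) :
    weyl χ s v y = χ (s.2 ⬝ᵥ y - s.2 ⬝ᵥ s.1 / 2) * v (y - s.1) := rfl

theorem weyl_zero (χ : AddChar F ℂ) : weyl χ (0 : (Fin n → F) × (Fin n → F)) = 1 := by
  ext v y
  simp [weyl_apply]

theorem weyl_weyl (h2 : (2 : F) ≠ 0) (χ : AddChar F ℂ) (s t : (Fin n → F) × (Fin n → F))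
    (v : QState F n) :
    weyl χ s (weyl χ t v) = χ (symplecticForm s t / 2) • weyl χ (s + t) v := by
  ext y
  simp only [weyl_apply, PiLp.smul_apply, smul_eq_mul]
  rw [← mul_assoc, ← mul_assoc, ← AddChar.map_add_eq_mul, ← AddChar.map_add_eq_mul]
  congr 2
  · simp only [symplecticForm, Prod.fst_add, Prod.snd_add, add_dotProduct, dotProduct_add,
      dotProduct_sub]
    field_simp
    ring
  · rw [Prod.fst_add, sub_sub]

/-- The half-phase in `weyl` makes the operators of an isotropic subspace an honest representation,
with no cocycle to correct. This is where odd characteristic enters. -/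
theorem weyl_weyl_of_symplecticForm_eq_zero (h2 : (2 : F) ≠ 0) (χ : AddChar F ℂ)
    {s t : (Fin n → F) × (Fin n → F)} (h : symplecticForm s t = 0) (v : QState F n) :
    weyl χ s (weyl χ t v) = weyl χ (s + t) v := by
  simp [weyl_weyl h2, h]

theorem weyl_comm (h2 : (2 : F) ≠ 0) (χ : AddChar F ℂ) (s t : (Fin n → F) × (Fin n → F))
    (v : QState F n) :
    weyl χ s (weyl χ t v) = χ (symplecticForm s t) • weyl χ t (weyl χ s v) := by
  rw [weyl_weyl h2, weyl_weyl h2, smul_smul, ← AddChar.map_add_eq_mul, add_comm t s,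
    symplecticForm_swap t s]
  congr 2
  field_simp
  ring

theorem weyl_injective (h2 : (2 : F) ≠ 0) (χ : AddChar F ℂ) (s : (Fin n → F) × (Fin n → F)) :
    Function.Injective (weyl χ s) := by
  refine Function.LeftInverse.injective (g := weyl χ (-s)) fun v => ?_
  rw [weyl_weyl_of_symplecticForm_eq_zero h2 χ (by simp [symplecticForm])]
  simp [weyl_zero]

theorem inner_weyl_weyl (χ : AddChar F ℂ) (s : (Fin n → F) × (Fin n → F)) (v w : QState F n) :
    inner ℂ (weyl χ s v) (weyl χ s w) = inner ℂ v w := by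
  simp only [PiLp.inner_apply, weyl_apply, RCLike.inner_apply, map_mul]
  rw [← Equiv.sum_comp (Equiv.subRight s.1) fun y => w.ofLp y * conj (v.ofLp y)]
  refine Finset.sum_congr rfl fun y _ => ?_
  rw [← AddChar.map_neg_eq_conj, mul_mul_mul_comm, ← AddChar.map_add_eq_mul]
  simp

open scoped Classical in
theorem trace_weyl {χ : AddChar F ℂ} (hχ : χ.IsPrimitive) (s : (Fin n → F) × (Fin n → F)) :
    LinearMap.trace ℂ _ (weyl χ s) = if s = 0 then (Fintype.card F : ℂ) ^ n else 0 := by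
  rw [LinearMap.trace_eq_sum_inner _ (EuclideanSpace.basisFun (Fin n → F) ℂ)]
  have key : ∀ y : Fin n → F, inner ℂ (EuclideanSpace.basisFun (Fin n → F) ℂ y)
      (weyl χ s (EuclideanSpace.basisFun (Fin n → F) ℂ y)) =
      if s.1 = 0 then χ (s.2 ⬝ᵥ y - s.2 ⬝ᵥ s.1 / 2) else 0 := by
    intro y
    rw [EuclideanSpace.basisFun_apply, EuclideanSpace.inner_single_left, weyl_apply]
    simp
  simp only [key]
  obtain ⟨u, b⟩ := s
  by_cases hu : u = 0
  · subst hu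
    simp only [dotProduct_zero, zero_div, sub_zero, if_true, Prod.mk_eq_zero, true_and]
    split_ifs with hb
    · simp [hb]
    · obtain ⟨i, hi⟩ := Function.ne_iff.1 hb
      obtain ⟨z, hz⟩ := AddChar.ne_one_iff.1 (hχ hi)
      let ψ : AddChar (Fin n → F) ℂ :=
        ⟨fun y => χ (b ⬝ᵥ y), by simp, fun x y => by
          rw [dotProduct_add, AddChar.map_add_eq_mul]⟩
      refine AddChar.sum_eq_zero_of_ne_one (ψ := ψ) (AddChar.ne_one_iff.2 ⟨Pi.single i z, ?_⟩)
      change χ (b ⬝ᵥ Pi.single i z) ≠ 1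
      simpa using hz
  · simp [hu]

/-- The stabilizer code of `S`: the common fixed vectors of the Weyl operators of `S`. -/
noncomputable def stabilizerCode (χ : AddChar F ℂ)
    (S : Submodule F ((Fin n → F) × (Fin n → F))) : Submodule ℂ (QState F n) :=
  ⨅ s : S, LinearMap.eqLocus (weyl χ s.1) LinearMap.id

theorem mem_stabilizerCode {χ : AddChar F ℂ} {S : Submodule F ((Fin n → F) × (Fin n → F))}
    {v : QState F n} : v ∈ stabilizerCode χ S ↔ ∀ s ∈ S, weyl χ s v = v := by
  simp [stabilizerCode, Submodule.mem_iInf, LinearMap.mem_eqLocus]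

open scoped Classical in
/-- The average of the Weyl operators of `S`. -/
noncomputable def weylAverage (χ : AddChar F ℂ)
    (S : Submodule F ((Fin n → F) × (Fin n → F))) : QState F n →ₗ[ℂ] QState F n :=
  (Fintype.card S : ℂ)⁻¹ • ∑ s : S, weyl χ s.1

theorem isProj_weylAverage (h2 : (2 : F) ≠ 0) (χ : AddChar F ℂ)
    {S : Submodule F ((Fin n → F) × (Fin n → F))}
    (hS : ∀ s ∈ S, ∀ t ∈ S, symplecticForm s t = 0) :
    LinearMap.IsProj (stabilizerCode χ S) (weylAverage χ S) := by
  classical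
  refine ⟨fun v => ?_, fun v hv => ?_⟩
  · rw [mem_stabilizerCode]
    intro s hs
    simp only [weylAverage, LinearMap.smul_apply, LinearMap.sum_apply, map_smul, map_sum]
    congr 1
    rw [← Equiv.sum_comp (Equiv.addLeft (⟨s, hs⟩ : S)) fun t => weyl χ t.1 v]
    exact Finset.sum_congr rfl fun t _ =>
      weyl_weyl_of_symplecticForm_eq_zero h2 χ (hS s hs t t.2) v
  · rw [mem_stabilizerCode] at hv
    have h : ∀ s : S, weyl χ s.1 v = v := fun s => hv s.1 s.2
    simp only [weylAverage, LinearMap.smul_apply, LinearMap.sum_apply, h, Finset.sum_const,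
      Finset.card_univ]
    rw [← Nat.cast_smul_eq_nsmul ℂ, smul_smul, inv_mul_cancel₀ (by simp), one_smul]

open scoped Classical in
theorem trace_weyl_comp_weylAverage (h2 : (2 : F) ≠ 0) {χ : AddChar F ℂ} (hχ : χ.IsPrimitive)
    {S : Submodule F ((Fin n → F) × (Fin n → F))} {t : (Fin n → F) × (Fin n → F)}
    (ht : ∀ s ∈ S, symplecticForm t s = 0) :
    LinearMap.trace ℂ _ (weyl χ t ∘ₗ weylAverage χ S) =
      if t ∈ S then (Fintype.card S : ℂ)⁻¹ * (Fintype.card F : ℂ) ^ n else 0 := by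
  have h : weyl χ t ∘ₗ weylAverage χ S =
      (Fintype.card S : ℂ)⁻¹ • ∑ s : S, weyl χ (t + s.1) := by
    ext1 v
    simp only [weylAverage, LinearMap.comp_apply, LinearMap.smul_apply, LinearMap.sum_apply,
      map_smul, map_sum]
    congr 1
    exact Finset.sum_congr rfl fun s _ =>
      weyl_weyl_of_symplecticForm_eq_zero h2 χ (ht s s.2) v
  rw [h, map_smul, map_sum]
  simp only [trace_weyl hχ, smul_eq_mul]
  split_ifs with hS
  · rw [Finset.sum_eq_single (-⟨t, hS⟩ : S)]
    · simp
    · intro s _ hs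
      rw [if_neg]
      intro h0
      exact hs (Subtype.ext (neg_eq_of_add_eq_zero_right h0).symm)
    · simp
  · rw [Finset.sum_eq_zero, mul_zero]
    intro s _
    rw [if_neg]
    intro h0
    exact hS (by rw [eq_neg_of_add_eq_zero_left h0]; exact S.neg_mem s.2)

/-- The dimension is the trace of the projection `weylAverage`, to which only the identity operator
contributes. -/
theorem card_mul_finrank_stabilizerCode (h2 : (2 : F) ≠ 0) {χ : AddChar F ℂ}
    (hχ : χ.IsPrimitive) {S : Submodule F ((Fin n → F) × (Fin n → F))}
    (hS : ∀ s ∈ S, ∀ t ∈ S, symplecticForm s t = 0) :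
    Nat.card S * Module.finrank ℂ (stabilizerCode χ S) = Fintype.card F ^ n := by
  classical
  have h := trace_weyl_comp_weylAverage h2 hχ (hS 0 S.zero_mem)
  rw [weyl_zero, if_pos S.zero_mem, Module.End.one_eq_id, LinearMap.id_comp,
    (isProj_weylAverage h2 χ hS).trace] at h
  rw [Nat.card_eq_fintype_card]
  have h0 : (Fintype.card S : ℂ) ≠ 0 := by simp
  rw [eq_inv_mul_iff_mul_eq₀ h0] at h
  exact_mod_cast h

end Stabilizer

/-! ### Errors detected by a stabilizer code -/

section Detection

variable {F : Type*} [Field F] [Fintype F] {p n : ℕ} [Fact p.Prime] [Algebra (ZMod p) F]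

/-- The additive character `z ↦ ζ ^ Tr z`. -/
noncomputable def traceChar (F : Type*) [Field F] [Algebra (ZMod p) F] {ζ : ℂ}
    (hζ : IsPrimitiveRoot ζ p) : AddChar F ℂ :=
  (AddChar.zmodChar p hζ.pow_eq_one).compAddMonoidHom (Algebra.trace (ZMod p) F).toAddMonoidHom

omit [Fintype F] in
theorem traceChar_apply {ζ : ℂ} (hζ : IsPrimitiveRoot ζ p) (z : F) :
    traceChar F hζ z = ζ ^ (Algebra.trace (ZMod p) F z).val := rfl

theorem isPrimitive_traceChar {ζ : ℂ} (hζ : IsPrimitiveRoot ζ p) :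
    (traceChar F hζ).IsPrimitive := by
  apply AddChar.IsPrimitive.of_ne_one
  obtain ⟨z, hz⟩ := Algebra.trace_surjective (ZMod p) F 1
  refine AddChar.ne_one_iff.2 ⟨z, ?_⟩
  have hp : 1 < p := (Fact.out : p.Prime).one_lt
  rw [traceChar_apply, hz, ZMod.val_one'' hp.ne', pow_one]
  exact hζ.ne_one hp

theorem QError.op_eq_smul_weyl (h2 : (2 : F) ≠ 0) {ζ : ℂ} (hζ : IsPrimitiveRoot ζ p) (e : QError F p n) :
    e.op ζ = (ζ ^ (e.phase : ℕ) * traceChar F hζ (-(e.clock ⬝ᵥ e.shift) / 2)) •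
      weyl (traceChar F hζ) (e.shift, e.clock) := by
  ext v y
  rw [LinearMap.smul_apply, PiLp.smul_apply, weyl_apply, smul_eq_mul, mul_assoc, ← mul_assoc _ _
    (v.ofLp _), ← AddChar.map_add_eq_mul, ← mul_assoc]
  change e.coeff ζ (y - e.shift) * v (y - e.shift) = _
  congr 1
  rw [QError.coeff, pow_add, ← traceChar_apply hζ]
  congr 2
  change e.clock ⬝ᵥ (y - e.shift) = _
  rw [dotProduct_sub]
  field_simp
  ring

/-- An error in `S` acts as a scalar, and one outside `S^⊥` maps the code to its orthogonal
complement. One in `S^⊥ \ S` preserves the code but has trace zero on it; a scalar of trace zero on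
a nonzero space is `0`, contradicting invertibility. -/
theorem qDetects_iff (h2 : (2 : F) ≠ 0) {ζ : ℂ} (hζ : IsPrimitiveRoot ζ p)
    {S : Submodule F ((Fin n → F) × (Fin n → F))}
    (hS : ∀ s ∈ S, ∀ t ∈ S, symplecticForm s t = 0) (e : QError F p n) :
    QDetects ζ (stabilizerCode (traceChar F hζ) S) e ↔
      ((∀ s ∈ S, symplecticForm s (e.shift, e.clock) = 0) → (e.shift, e.clock) ∈ S) := by
  classical
  set χ := traceChar F hζ with hχdef
  have hχ : χ.IsPrimitive := isPrimitive_traceChar hζ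
  obtain ⟨c₀, hc₀, hop⟩ : ∃ c₀ : ℂ, c₀ ≠ 0 ∧ e.op ζ = c₀ • weyl χ (e.shift, e.clock) :=
    ⟨_, mul_ne_zero (pow_ne_zero _ (hζ.ne_zero (Fact.out : p.Prime).ne_zero))
      (AddChar.val_isUnit χ _).ne_zero, QError.op_eq_smul_weyl h2 hζ e⟩
  generalize (e.shift, e.clock) = t at hop
  simp only [QDetects, hop, LinearMap.smul_apply, inner_smul_right]
  constructor
  · rintro ⟨c, hc⟩ ht
    by_contra htS
    have ht' : ∀ s ∈ S, symplecticForm t s = 0 := fun s hs => by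
      rw [symplecticForm_swap, ht s hs, neg_zero]
    have hW : ∀ w ∈ stabilizerCode χ S, c₀ • weyl χ t w = c • w := by
      intro w hw
      have hmem : weyl χ t w ∈ stabilizerCode χ S := by
        rw [mem_stabilizerCode] at hw ⊢
        intro s hs
        rw [weyl_comm h2, ht s hs, hw s hs, AddChar.map_zero_eq_one, one_smul]
      -- The difference lies in the code, so detection tested against it shows that its norm is
      -- zero.
      have hdiff := Submodule.sub_mem _ (Submodule.smul_mem _ c₀ hmem) (Submodule.smul_mem _ c hw)
      rw [← sub_eq_zero, ← inner_self_eq_zero (𝕜 := ℂ)]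
      conv_lhs => rw [inner_sub_right, inner_smul_right, inner_smul_right]
      rw [hc _ hdiff _ hw, sub_self]
    have hproj := isProj_weylAverage h2 χ hS
    have hcomp : c₀ • (weyl χ t ∘ₗ weylAverage χ S) = c • weylAverage χ S := by
      ext1 v
      exact hW _ (hproj.map_mem v)
    have htr := congrArg (LinearMap.trace ℂ _) hcomp
    rw [map_smul, map_smul, trace_weyl_comp_weylAverage h2 hχ ht', if_neg htS, hproj.trace,
      smul_zero, eq_comm, smul_eq_mul, mul_eq_zero] at htr
    have hfin : Module.finrank ℂ (stabilizerCode χ S) ≠ 0 := fun h0 => by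
      have := card_mul_finrank_stabilizerCode h2 hχ hS
      rw [h0, mul_zero] at this
      exact pow_ne_zero n Fintype.card_ne_zero this.symm
    obtain rfl : c = 0 := htr.resolve_right (by exact_mod_cast hfin)
    refine hfin (Submodule.finrank_eq_zero.2 ((Submodule.eq_bot_iff _).2 fun w hw => ?_))
    have := hW w hw
    rw [zero_smul, smul_eq_zero_iff_right hc₀] at this
    exact weyl_injective h2 χ t (by rw [this, map_zero])
  · intro h
    by_cases ht : ∀ s ∈ S, symplecticForm s t = 0
    · refine ⟨c₀, fun v _ w hw => ?_⟩
      rw [mem_stabilizerCode.1 hw t (h ht)]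
    · push Not at ht
      obtain ⟨s, hs, hst⟩ := ht
      obtain ⟨z, hz⟩ := AddChar.ne_one_iff.1 (hχ hst)
      refine ⟨0, fun v hv w hw => ?_⟩
      rw [mem_stabilizerCode] at hv hw
      -- `χ` may be trivial at `symplecticForm s t` itself; linearity of `S` over `F` permits
      -- rescaling by `z`.
      have hzs := S.smul_mem z hs
      have key := inner_weyl_weyl χ (z • s) v (weyl χ t w)
      rw [weyl_comm h2, hv _ hzs, hw _ hzs, inner_smul_right, symplecticForm_smul_left] at key
      have h0 : inner ℂ v (weyl χ t w) = 0 := by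
        by_contra hne
        refine hz ?_
        rw [AddChar.mulShift_apply, mul_comm]
        exact mul_right_cancel₀ hne (by rw [key, one_mul])
      rw [h0, mul_zero, zero_mul]

end Detection

/-! ### Conjugation and norm in the quadratic extension -/

section QuadraticExtension

variable {F : Type*} [Field F] [Fintype F] {ν : F}

instance QuadraticAlgebra.finite : Finite (QuadraticAlgebra F ν 0) :=
  Finite.of_equiv _ (QuadraticAlgebra.equivProd ν 0).symm

theorem QuadraticAlgebra.natCard_eq_sq :
    Nat.card (QuadraticAlgebra F ν 0) = Fintype.card F ^ 2 := by
  rw [Nat.card_congr (QuadraticAlgebra.equivProd ν 0), Nat.card_prod, Nat.card_eq_fintype_card, sq]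

variable [hν : Fact (∀ r : F, r ^ 2 ≠ ν + 0 * r)]

open scoped QuadraticAlgebra in
-- Both sides are `F`-linear, and Euler's criterion for the nonsquare `ν = ω²` gives `ω^q = -ω`.
theorem QuadraticAlgebra.star_eq_pow_card (hF : ringChar F ≠ 2) (x : QuadraticAlgebra F ν 0) :
    star x = x ^ Fintype.card F := by
  have hns : ¬ IsSquare ν := by
    rintro ⟨r, hr⟩
    exact hν.out r (by rw [hr]; ring)
  have h0 : ν ≠ 0 := fun h => hns (h ▸ IsSquare.zero)
  have h1 : ν ^ (Fintype.card F / 2) = -1 :=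
    (FiniteField.pow_dichotomy hF h0).resolve_left
      fun h => hns ((FiniteField.isSquare_iff hF h0).2 h)
  have hω : (ω : QuadraticAlgebra F ν 0) ^ Fintype.card F = -ω := by
    conv_lhs => rw [← Nat.two_mul_div_two_add_one_of_odd
      (Nat.odd_iff.2 (FiniteField.odd_card_of_char_ne_two hF))]
    rw [pow_succ, pow_mul, sq, omega_mul_omega_eq_algebraMap, map_zero, zero_mul, add_zero, ← map_pow, h1, map_neg, map_one, neg_one_mul]
  have h := FiniteField.coe_frobeniusAlgHom F (QuadraticAlgebra F ν 0)
  have h' := congrFun h x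
  rw [← h']
  obtain ⟨u, b⟩ := x
  rw [mk_eq_add_smul_omega, map_add, AlgHom.commutes, map_smul, h]
  simp only [hω]
  ext <;> simp [QuadraticAlgebra.algebraMap_eq]

theorem QuadraticAlgebra.exists_mul_star_eq (t : F) :
    ∃ v : QuadraticAlgebra F ν 0, v * star v = algebraMap F _ t := by
  obtain ⟨v, hv⟩ := FiniteField.norm_surjective F (QuadraticAlgebra F ν 0) t
  refine ⟨v, ?_⟩
  rw [← algebraMap_norm_eq_mul_star, ← det_toLinearMap_eq_norm, ← hv]
  rfl

end QuadraticExtension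

/-! ### Power sums over roots of unity, and nonvanishing traces -/

section RootsOfUnity

/-- With `k = (a+1)m` and `J = k+1+j`, a quotient `c` would give `J - (i+τ) = (q+1)C` for `C = J -
2mc`. The left side is positive, so `C ≥ 1`; then `2ma < qC + i + τ = 2mc = J - C < 2k = 2m(a+1)`,
that is, `a < c < a+1`. -/
theorem not_dvd_exponent {a m q i j τ : ℕ} (hq : q = 2 * a * m + 1) (hτ : τ ≤ 1)
    (hi : i < (a + 1) * m) (hj : j < (a + 1) * m) :
    ¬ 2 * m * (q + 1) ∣ q * ((a + 1) * m + 1) + τ + i + q * j := by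
  rintro ⟨c, hc⟩
  zify at *
  simp only [hq] at hc
  generalize hk : ((a : ℤ) + 1) * m = k at *
  obtain ⟨J, hJ⟩ : ∃ J, J = k + 1 + j := ⟨_, rfl⟩
  obtain ⟨C, hC⟩ : ∃ C, C = J - 2 * m * c := ⟨_, rfl⟩
  have h1 : (J : ℤ) - (i + τ) = (2 * a * m + 1 + 1) * C := by
    subst hC hJ
    linear_combination -hc
  have hC1 : 0 < C := by
    by_contra! h
    have : (2 * (a : ℤ) * m + 1 + 1) * C ≤ 0 :=
      mul_nonpos_of_nonneg_of_nonpos (by positivity) h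
    lia
  have h2 : (2 * (a : ℤ) * m + 1) * 1 ≤ (2 * a * m + 1) * C :=
    mul_le_mul_of_nonneg_left hC1 (by positivity)
  have hm : (0 : ℤ) < 2 * m := by
    rcases Nat.eq_zero_or_pos m with rfl | h
    · simp at hk
      lia
    · positivity
  have h3 : 2 * (m : ℤ) * a < 2 * m * c := by linarith
  have h4 : 2 * (m : ℤ) * c < 2 * m * (a + 1) := by linarith
  have h5 := lt_of_mul_lt_mul_left h3 hm.le
  have h6 := lt_of_mul_lt_mul_left h4 hm.le
  lia

theorem IsPrimitiveRoot.sum_fin_pow_pow_eq_zero {K : Type*} [Field K] {α : K} {n t : ℕ}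
    (hα : IsPrimitiveRoot α n) (ht : ¬ n ∣ t) : ∑ s : Fin n, (α ^ (s : ℕ)) ^ t = 0 := by
  rw [Fin.sum_univ_eq_sum_range (fun s => (α ^ s) ^ t) n]
  simp_rw [pow_right_comm α _ t]
  have h : α ^ t - 1 ≠ 0 := by
    rwa [sub_ne_zero, Ne, hα.pow_eq_one_iff_dvd]
  refine mul_left_cancel₀ h ?_
  rw [mul_geom_sum, pow_right_comm, hα.pow_eq_one, one_pow, sub_self, mul_zero]

variable {K : Type*} [Field K] [Finite K]

theorem exists_isPrimitiveRoot_of_natCard : ∃ g : K, IsPrimitiveRoot g (Nat.card K - 1) := by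
  obtain ⟨g, hg⟩ := IsCyclic.exists_ofOrder_eq_natCard (α := Kˣ)
  refine ⟨g, ?_⟩
  rw [← Nat.card_units, ← hg, IsPrimitiveRoot.coe_units_iff]
  exact IsPrimitiveRoot.orderOf g

/-- Nonzero `w` of trace zero satisfy `w^(q-1) = -1`, so they all share the quadratic character
`(-1)^((q+1)/2)`. Taking `c` of the other character excludes every `c z²`. -/
theorem exists_mul_sq_add_pow_ne_zero {q : ℕ} (hq : Odd q) (hK : Nat.card K = q ^ 2)
    (h2 : (2 : K) ≠ 0) :
    ∃ c : K, ∀ z : K, z ≠ 0 → c * z ^ 2 + (c * z ^ 2) ^ q ≠ 0 := by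
  have hneg : (-1 : K) ≠ 1 := fun h => h2 (by linear_combination -h)
  obtain ⟨r, rfl⟩ := hq
  have hcard : Nat.card K - 1 = 2 * (2 * r * (r + 1)) := by
    rw [hK]
    refine Nat.sub_eq_of_eq_add ?_
    ring
  have hone : ∀ z : K, z ≠ 0 → z ^ (2 * (2 * r * (r + 1))) = 1 := fun z hz => by
    have := Fintype.ofFinite K
    rw [← hcard, Nat.card_eq_fintype_card]
    exact FiniteField.pow_card_sub_one_eq_one z hz
  obtain ⟨c, hc0, hc⟩ : ∃ c : K, c ≠ 0 ∧ c ^ (2 * r * (r + 1)) ≠ (-1) ^ (r + 1) := by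
    rcases neg_one_pow_eq_or K (r + 1) with h | h
    · obtain ⟨g, hg⟩ := exists_isPrimitiveRoot_of_natCard (K := K)
      have hpos : 0 < 2 * (2 * r * (r + 1)) := by
        rw [← hcard]
        have := Finite.one_lt_card (α := K)
        lia
      rw [hcard] at hg
      refine ⟨g, hg.ne_zero hpos.ne', ?_⟩
      rw [h]
      exact hg.pow_ne_one_of_pos_of_lt (by lia) (by lia)
    · exact ⟨1, one_ne_zero, by rw [h, one_pow]; exact hneg.symm⟩
  refine ⟨c, fun z hz h => hc ?_⟩
  have hcz : c * z ^ 2 ≠ 0 := mul_ne_zero hc0 (pow_ne_zero 2 hz)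
  have h1 : (c * z ^ 2) ^ (2 * r) = -1 := by
    refine mul_right_cancel₀ hcz ?_
    rw [← pow_succ]
    linear_combination h
  rw [← h1, ← pow_mul, mul_pow, ← pow_mul, hone z hz, mul_one]

end RootsOfUnity

/-! ### The multipliers of the Reed–Solomon code -/

section Weights

variable {F : Type*} [Field F] [Fintype F] {ν : F} [hν : Fact (∀ r : F, r ^ 2 ≠ ν + 0 * r)]

/-- Multipliers which make the generalized Reed–Solomon code on the `n`-th roots of unity of the
quadratic extension Hermitian self-orthogonal, `n = 2 m (q + 1)`. -/
theorem exists_grs_multipliers {q a m : ℕ} (hodd : Odd q) (hqam : q = 2 * a * m + 1)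
    (hF : Fintype.card F = q) :
    ∃ x v : Fin (2 * m * (q + 1)) → QuadraticAlgebra F ν 0, Function.Injective x ∧
      (∀ s, v s ≠ 0) ∧ ∀ i < (a + 1) * m, ∀ j < (a + 1) * m,
        ∑ s, v s * x s ^ i * star (v s * x s ^ j) = 0 := by
  have hchar : ringChar F ≠ 2 := by
    intro h
    have := FiniteField.even_card_of_char_two h
    rw [hF] at this
    exact absurd this (by rw [Nat.odd_iff.1 hodd]; exact one_ne_zero)
  have h2 : (2 : QuadraticAlgebra F ν 0) ≠ 0 := by
    have := Ring.two_ne_zero hchar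
    rw [← map_ofNat (algebraMap F (QuadraticAlgebra F ν 0)) 2]
    exact (map_ne_zero _).2 this
  have hstar := QuadraticAlgebra.star_eq_pow_card (ν := ν) hchar
  have hK : Nat.card (QuadraticAlgebra F ν 0) = q ^ 2 := by
    rw [QuadraticAlgebra.natCard_eq_sq, hF]
  rw [hF] at hstar
  set n := 2 * m * (q + 1) with hn
  have hqn : q ^ 2 - 1 = a * n := by
    refine Nat.sub_eq_of_eq_add ?_
    rw [hn, hqam]
    ring
  have hq1 : 1 < q := by
    rw [← hF]
    exact Fintype.one_lt_card
  have hpos : 0 < q ^ 2 - 1 := by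
    have : q ^ 2 = q * q := sq q
    have : 1 < q * q := one_lt_mul'' hq1 hq1
    lia
  obtain ⟨g, hg⟩ := exists_isPrimitiveRoot_of_natCard (K := QuadraticAlgebra F ν 0)
  rw [hK] at hg
  have hα : IsPrimitiveRoot (g ^ a) n := hg.pow hpos hqn
  set α := g ^ a with hαdef
  have hα0 : α ≠ 0 := pow_ne_zero a (hg.ne_zero hpos.ne')
  obtain ⟨c, hc⟩ := exists_mul_sq_add_pow_ne_zero hodd hK h2
  set k := (a + 1) * m with hk
  -- The correction `τ` makes the exponent even, so that `x^(2E)` is a square and the choice of `c`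
  -- applies.
  obtain ⟨τ, hτ, E, hE⟩ : ∃ τ ≤ 1, ∃ E, q * (k + 1) + τ = 2 * E := by
    rcases Nat.even_or_odd' (q * (k + 1)) with ⟨E, h | h⟩
    · exact ⟨0, zero_le_one, E, h⟩
    · exact ⟨1, le_rfl, E + 1, by lia⟩
  choose v hv using fun s : Fin n => QuadraticAlgebra.exists_mul_star_eq (ν := ν)
    (QuadraticAlgebra.trace (c * ((α ^ (s : ℕ)) ^ E) ^ 2))
  simp only [QuadraticAlgebra.algebraMap_trace_eq_add_star, hstar] at hv
  refine ⟨fun s => α ^ (s : ℕ), v, fun s t h => Fin.ext (hα.pow_inj s.2 t.2 h), fun s h => ?_, ?_⟩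
  · refine hc ((α ^ (s : ℕ)) ^ E) (pow_ne_zero _ (pow_ne_zero _ hα0)) ?_
    rw [← hv, h, zero_mul]
  · intro i hi j hj
    have key : ∀ s : Fin n, v s * (α ^ (s : ℕ)) ^ i * star (v s * (α ^ (s : ℕ)) ^ j) =
        c * (α ^ (s : ℕ)) ^ (2 * E + i + q * j) +
          c ^ q * (α ^ (s : ℕ)) ^ (q * (2 * E) + i + q * j) := by
      intro s
      rw [hstar, mul_pow, mul_mul_mul_comm, hv]
      ring
    simp only [key, Finset.sum_add_distrib, ← Finset.mul_sum]
    rw [hα.sum_fin_pow_pow_eq_zero, hα.sum_fin_pow_pow_eq_zero, mul_zero, mul_zero, add_zero]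
    · intro hdvd
      refine not_dvd_exponent hqam hτ hj hi (?_ : n ∣ _)
      rw [← hk, hE]
      -- As `q² ≡ 1` modulo `n`, multiplying by `q` turns the conjugate exponent into the first one
      -- with `i` and `j` exchanged.
      have h3 : n ∣ q * (q * (2 * E) + i + q * j) := hdvd.mul_left q
      have h4 : q * (q * (2 * E) + i + q * j) =
          (2 * E + j + q * i) + n * (a * (2 * E + j)) := by
        have h5 : q ^ 2 = a * n + 1 := by lia
        linear_combination (2 * E + j) * h5
      rw [h4] at h3
      exact (Nat.dvd_add_left (dvd_mul_right _ _)).1 h3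
    · rw [← hE]
      exact not_dvd_exponent hqam hτ hi hj

end Weights

/-! ### Generalized Reed–Solomon codes and their duals -/

section ReedSolomon

variable {K : Type*} [Field K] {n k : ℕ}

/-- The encoding map of the generalized Reed–Solomon code with evaluation points `x` and
multipliers `v`. -/
def grsEncode (k : ℕ) (x v : Fin n → K) : (Fin k → K) →ₗ[K] (Fin n → K) where
  toFun c s := v s * ∑ i : Fin k, x s ^ (i : ℕ) * c i
  map_add' c c' := by
    ext s
    simp [mul_add, Finset.sum_add_distrib]
  map_smul' r c := by
    ext s
    simp [Finset.mul_sum, mul_left_comm]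

theorem grsEncode_apply (x v : Fin n → K) (c : Fin k → K) (s : Fin n) :
    grsEncode k x v c s = v s * ∑ i : Fin k, x s ^ (i : ℕ) * c i := rfl

theorem eq_zero_of_grsEncode_eq_zero {x v : Fin n → K} (hx : Function.Injective x)
    (hv : ∀ s, v s ≠ 0) {c : Fin k → K} {T : Finset (Fin n)} (hT : T.card = k)
    (h : ∀ s ∈ T, grsEncode k x v c s = 0) : c = 0 := by
  refine Matrix.eq_zero_of_forall_index_sum_pow_mul_eq_zero
    (hx.comp (T.orderEmbOfFin hT).injective) fun j => ?_
  exact (mul_eq_zero.1 (h _ (T.orderEmbOfFin_mem hT j))).resolve_left (hv _)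

theorem eq_zero_of_moments_eq_zero {x t : Fin n → K} (hx : Function.Injective x)
    {T : Finset (Fin n)} (hT : T.card = k) (ht : ∀ s ∉ T, t s = 0)
    (h : ∀ i < k, ∑ s, t s * x s ^ i = 0) : t = 0 := by
  have h0 : (fun j => t (T.orderEmbOfFin hT j)) = 0 := by
    refine Matrix.eq_zero_of_forall_pow_sum_mul_pow_eq_zero
      (hx.comp (T.orderEmbOfFin hT).injective) fun i => ?_
    rw [← h i i.2, ← Finset.sum_subset T.subset_univ fun s _ hs => by rw [ht s hs, zero_mul]]
    conv_rhs => rw [← T.image_orderEmbOfFin_univ hT]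
    rw [Finset.sum_image (T.orderEmbOfFin hT).injective.injOn]
    rfl
  ext s
  by_cases hs : s ∈ T
  · rw [← Finset.mem_coe, ← T.range_orderEmbOfFin hT] at hs
    obtain ⟨j, rfl⟩ := hs
    exact congrFun h0 j
  · exact ht s hs

/-- On the first `k+1` coordinates these are `k` equations in `k+1` unknowns. The solution provides
the dual word of minimum weight. -/
theorem exists_moments_eq_zero (hk : k < n) (x v : Fin n → K) :
    ∃ t : Fin n → K, t ≠ 0 ∧ (∀ s : Fin n, k < s → t s = 0) ∧
      ∀ i < k, ∑ s, v s * x s ^ i * t s = 0 := by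
  let f : (Fin (k + 1) → K) →ₗ[K] (Fin k → K) :=
    Matrix.mulVecLin (Matrix.of fun (i : Fin k) (s : Fin (k + 1)) =>
      v (Fin.castLE hk s) * x (Fin.castLE hk s) ^ (i : ℕ))
  obtain ⟨u, hu, hu0⟩ := (Submodule.ne_bot_iff _).1
    (LinearMap.ker_ne_bot_of_finrank_lt (f := f) (by simp))
  have hinj : Function.Injective (Fin.castLE hk : Fin (k + 1) → Fin n) :=
    Fin.castLE_injective hk
  obtain ⟨t, ht⟩ : ∃ t : Fin n → K, t = Function.extend (Fin.castLE hk) u 0 := ⟨_, rfl⟩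
  have hext : ∀ s, t (Fin.castLE hk s) = u s := fun s => by rw [ht, hinj.extend_apply]
  have hout : ∀ s : Fin n, s ∉ Set.range (Fin.castLE hk) → t s = 0 := fun s hs => by
    rw [ht, Function.extend_apply' _ _ _ hs, Pi.zero_apply]
  refine ⟨t, fun h => hu0 ?_, fun s hs => hout s ?_,
    fun i hi => ?_⟩
  · ext s
    rw [← hext s, h]
    rfl
  · rintro ⟨j, rfl⟩
    rw [Fin.val_castLE] at hs
    lia
  · have h := congrFun (LinearMap.mem_ker.1 hu) ⟨i, hi⟩
    refine Eq.trans (Eq.symm ?_) h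
    refine Fintype.sum_of_injective (Fin.castLE hk) hinj _ _ (fun s hs => ?_) fun s => ?_
    · rw [hout s hs, mul_zero]
    · rw [hext]
      rfl

end ReedSolomon

/-! ### From Hermitian self-orthogonal codes to quantum codes -/

section HermitianConstruction

variable {F : Type*} [Field F] [Fintype F] {ν : F} {n : ℕ}

/-- The identification of `F^n × F^n` with `K^n`, `K = F ⊕ F ω`. -/
def pairToQuadratic (ν : F) (n : ℕ) :
    ((Fin n → F) × (Fin n → F)) ≃ₗ[F] (Fin n → QuadraticAlgebra F ν 0) where
  toFun s i := ⟨s.1 i, s.2 i⟩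
  invFun t := (fun i => (t i).re, fun i => (t i).im)
  map_add' _ _ := rfl
  map_smul' _ _ := rfl
  left_inv _ := rfl
  right_inv _ := rfl

omit [Fintype F] in
theorem im_sum_mul_star_pairToQuadratic (s t : (Fin n → F) × (Fin n → F)) :
    (∑ i, pairToQuadratic ν n s i * star (pairToQuadratic ν n t i)).im =
      symplecticForm s t := by
  have h := map_sum (QuadraticAlgebra.imₗ ν (0 : F))
    (fun i => pairToQuadratic ν n s i * star (pairToQuadratic ν n t i)) Finset.univ
  refine h.trans ?_
  rw [symplecticForm, dotProduct, dotProduct, ← Finset.sum_sub_distrib]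
  refine Finset.sum_congr rfl fun i _ => ?_
  simp [QuadraticAlgebra.imₗ, pairToQuadratic]
  ring

omit [Fintype F] in
theorem QError.weight_eq_ncard {p : ℕ} (e : QError F p n) :
    e.weight = {i | pairToQuadratic ν n (e.shift, e.clock) i ≠ 0}.ncard := by
  rw [QError.weight]
  congr 1
  ext i
  simp [pairToQuadratic, QuadraticAlgebra.ext_iff]

variable [hν : Fact (∀ r : F, r ^ 2 ≠ ν + 0 * r)]

/-- The Hermitian construction: a Hermitian self-orthogonal code `C` yields a stabilizer code. -/
theorem exists_qCode_of_hermitian_selfOrthogonal {p : ℕ} [Fact p.Prime] [Algebra (ZMod p) F]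
    (h2 : (2 : F) ≠ 0) {ζ : ℂ} (hζ : IsPrimitiveRoot ζ p) {k d : ℕ} (hkn : 2 * k ≤ n)
    (C : Submodule (QuadraticAlgebra F ν 0) (Fin n → QuadraticAlgebra F ν 0))
    (hcard : Nat.card C = Fintype.card F ^ (2 * k))
    (hC : ∀ s ∈ C, ∀ t ∈ C, ∑ i, s i * star (t i) = 0)
    (hlt : ∀ t : Fin n → QuadraticAlgebra F ν 0, {i | t i ≠ 0}.ncard < d →
      (∀ s ∈ C, ∑ i, s i * star (t i) = 0) → t ∈ C)
    (hd : ∃ t : Fin n → QuadraticAlgebra F ν 0, {i | t i ≠ 0}.ncard = d ∧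
      (∀ s ∈ C, ∑ i, s i * star (t i) = 0) ∧ t ∉ C) :
    ∃ Q : Submodule ℂ (QState F n), IsQCode p ζ Q (n - 2 * k) d := by
  let S : Submodule F ((Fin n → F) × (Fin n → F)) :=
    (C.restrictScalars F).comap (pairToQuadratic ν n).toLinearMap
  have hmem : ∀ s, s ∈ S ↔ pairToQuadratic ν n s ∈ C := fun s => Iff.rfl
  have hS : ∀ s ∈ S, ∀ t ∈ S, symplecticForm s t = 0 := fun s hs t ht => by
    rw [← im_sum_mul_star_pairToQuadratic (ν := ν), hC _ ((hmem s).1 hs) _ ((hmem t).1 ht), QuadraticAlgebra.im_zero]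
  have hperp : ∀ t, (∀ s ∈ S, symplecticForm s t = 0) ↔
      ∀ s ∈ C, ∑ i, s i * star (pairToQuadratic ν n t i) = 0 := by
    intro t
    constructor
    · intro h
      have him : ∀ s ∈ C, (∑ i, s i * star (pairToQuadratic ν n t i)).im = 0 := by
        intro s hs
        obtain ⟨s, rfl⟩ := (pairToQuadratic ν n).surjective s
        rw [im_sum_mul_star_pairToQuadratic]
        exact h s hs
      intro s hs
      -- Since `(ωz).im = z.re` and `C` is `K`-linear, vanishing of all imaginary parts forces
      -- vanishing of the real parts.
      have h1 := him _ (C.smul_mem QuadraticAlgebra.omega hs)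
      simp only [Pi.smul_apply, smul_eq_mul, mul_assoc, ← Finset.mul_sum] at h1
      ext
      · simpa using h1
      · exact him s hs
    · intro h s hs
      rw [← im_sum_mul_star_pairToQuadratic (ν := ν), h _ ((hmem s).1 hs), QuadraticAlgebra.im_zero]
  have hScard : Nat.card S = Fintype.card F ^ (2 * k) := by
    rw [← hcard]
    exact Nat.card_congr ((pairToQuadratic ν n).toEquiv.subtypeEquiv fun s => Iff.rfl)
  refine ⟨stabilizerCode (traceChar F hζ) S, ?_, fun e he => ?_, ?_⟩
  · have h := card_mul_finrank_stabilizerCode h2 (isPrimitive_traceChar hζ) hS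
    rw [hScard] at h
    refine Nat.eq_of_mul_eq_mul_left (pow_pos (Fintype.card_pos (α := F)) (2 * k)) ?_
    rw [h, ← pow_add, Nat.add_sub_cancel' hkn]
  · rw [qDetects_iff h2 hζ hS, hperp, hmem]
    rw [QError.weight_eq_ncard (ν := ν)] at he
    exact hlt _ he
  · obtain ⟨t, htd, ht, htC⟩ := hd
    obtain ⟨⟨u, b⟩, rfl⟩ := (pairToQuadratic ν n).surjective t
    refine ⟨⟨0, u, b⟩, ?_, ?_⟩
    · rw [QError.weight_eq_ncard (ν := ν)]
      exact htd
    · rw [qDetects_iff h2 hζ hS, hperp, hmem]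
      exact fun h => htC (h ht)

/-- Hermitian self-orthogonal generalized Reed–Solomon codes yield quantum MDS codes. -/
theorem exists_qCode_of_grs {p : ℕ} [Fact p.Prime] [Algebra (ZMod p) F]
    (h2 : (2 : F) ≠ 0) {ζ : ℂ} (hζ : IsPrimitiveRoot ζ p) {k : ℕ} (hkn : 2 * k < n)
    {x v : Fin n → QuadraticAlgebra F ν 0} (hx : Function.Injective x) (hv : ∀ s, v s ≠ 0)
    (horth : ∀ i < k, ∀ j < k, ∑ s, v s * x s ^ i * star (v s * x s ^ j) = 0) :
    ∃ Q : Submodule ℂ (QState F n), IsQCode p ζ Q (n - 2 * k) (k + 1) := by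
  have hinner : ∀ (c : Fin k → QuadraticAlgebra F ν 0) (t : Fin n → QuadraticAlgebra F ν 0),
      ∑ s, grsEncode k x v c s * star (t s) =
        ∑ i, c i * ∑ s, v s * x s ^ (i : ℕ) * star (t s) := by
    intro c t
    simp only [grsEncode_apply, Finset.mul_sum, Finset.sum_mul]
    rw [Finset.sum_comm]
    exact Finset.sum_congr rfl fun i _ => Finset.sum_congr rfl fun s _ => by ring
  have hdual : ∀ t : Fin n → QuadraticAlgebra F ν 0,
      (∀ s ∈ LinearMap.range (grsEncode k x v), ∑ i, s i * star (t i) = 0) ↔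
        ∀ i < k, ∑ s, v s * x s ^ i * star (t s) = 0 := by
    intro t
    constructor
    · intro h i hi
      have := h _ ⟨Pi.single ⟨i, hi⟩ 1, rfl⟩
      rw [hinner, Finset.sum_eq_single ⟨i, hi⟩] at this
      · simpa using this
      · intro j _ hj
        simp [hj]
      · simp
    · rintro h _ ⟨c, rfl⟩
      rw [hinner]
      exact Finset.sum_eq_zero fun i _ => by rw [h i i.2, mul_zero]
  have hinj : Function.Injective (grsEncode k x v) := by
    obtain ⟨T, -, hT⟩ := Finset.exists_subset_card_eq (s := (Finset.univ : Finset (Fin n))) (n := k)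
      (by rw [Finset.card_univ, Fintype.card_fin]; lia)
    rw [injective_iff_map_eq_zero]
    exact fun c hc => eq_zero_of_grsEncode_eq_zero hx hv hT fun s _ => congrFun hc s
  have hsmall : ∀ t : Fin n → QuadraticAlgebra F ν 0, {i | t i ≠ 0}.ncard < k + 1 →
      (∀ i < k, ∑ s, v s * x s ^ i * star (t s) = 0) → t = 0 := by
    classical
    intro t ht h
    rw [Set.ncard_eq_toFinset_card'] at ht
    obtain ⟨T, hsub, hT⟩ := Finset.exists_superset_card_eq (Nat.lt_succ_iff.1 ht)
      (by rw [Fintype.card_fin]; lia)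
    have h0 : (fun s => v s * star (t s)) = 0 := by
      refine eq_zero_of_moments_eq_zero hx hT (fun s hs => ?_) fun i hi => ?_
      · have : t s = 0 := by
          by_contra hne
          exact hs (hsub (by simpa using hne))
        rw [this, star_zero, mul_zero]
      · rw [← h i hi]
        exact Finset.sum_congr rfl fun s _ => by ring
    ext1 s
    exact star_eq_zero.1 ((mul_eq_zero.1 (congrFun h0 s)).resolve_left (hv s))
  refine exists_qCode_of_hermitian_selfOrthogonal h2 hζ (ν := ν) hkn.le
    (LinearMap.range (grsEncode k x v)) ?_ ?_ (fun t ht h => ?_) ?_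
  · rw [← Nat.card_congr (LinearEquiv.ofInjective _ hinj).toEquiv, Nat.card_fun,
      QuadraticAlgebra.natCard_eq_sq, Nat.card_fin, pow_mul]
  · rintro s hs _ ⟨c, rfl⟩
    refine (hdual _).2 (fun i hi => ?_) s hs
    have h : ∀ s, v s * x s ^ i * star (grsEncode k x v c s) =
        ∑ j : Fin k, star (c j) * (v s * x s ^ i * star (v s * x s ^ (j : ℕ))) := fun s => by
      simp only [grsEncode_apply, Finset.mul_sum, star_sum, star_mul']
      exact Finset.sum_congr rfl fun j _ => by ring
    simp only [h]
    rw [Finset.sum_comm]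
    refine Finset.sum_eq_zero fun j _ => ?_
    rw [← Finset.mul_sum, horth i hi j j.2, mul_zero]
  · rw [hsmall t ht ((hdual t).1 h)]
    exact Submodule.zero_mem _
  · obtain ⟨t, ht0, hsupp, ht⟩ := exists_moments_eq_zero (show k < n by lia) x v
    have hperp : ∀ i < k, ∑ s, v s * x s ^ i * star (star t s) = 0 := by
      simpa only [Pi.star_apply, star_star] using ht
    have hne : star t ≠ 0 := star_ne_zero.2 ht0
    refine ⟨star t, le_antisymm ?_ ?_, (hdual _).2 hperp, ?_⟩
    · rw [← Nat.card_Iio (k + 1), ← Set.toFinset_Iio, ← Set.ncard_eq_toFinset_card']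
      refine Set.ncard_le_ncard_of_injOn Fin.val (fun s hs => ?_) Fin.val_injective.injOn
        (Set.finite_Iio _)
      by_contra h
      refine hs ?_
      rw [Pi.star_apply, hsupp s (by simpa using h), star_zero]
    · by_contra! h
      exact hne (hsmall _ h hperp)
    · rintro ⟨c, hc⟩
      -- The word vanishes at the last `n-k-1 ≥ k` positions, because `2k < n`, while a codeword of
      -- `C` with `k` zeros is zero.
      obtain ⟨T, hsub, hT⟩ := Finset.exists_subset_card_eq
        (s := Finset.Ioi (⟨k, by lia⟩ : Fin n)) (n := k) (by rw [Fin.card_Ioi]; lia)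
      have hc0 : c = 0 := eq_zero_of_grsEncode_eq_zero hx hv hT fun s hs => by
        rw [hc, Pi.star_apply, hsupp s (Fin.lt_def.1 (Finset.mem_Ioi.1 (hsub hs))), star_zero]
      exact hne (by rw [← hc, hc0, map_zero])

end HermitianConstruction

/-! ### The quantum MDS codes -/

theorem mainTheorem1 (q a m : ℕ) (hq : IsPrimePow q) (hodd : Odd q) (hqam : q = 2 * a * m + 1)
    (p : ℕ) [Fact p.Prime] (F : Type*) [Field F] [Fintype F] [Algebra (ZMod p) F]
    (hF : Fintype.card F = q) (ζ : ℂ) (hζ : IsPrimitiveRoot ζ p)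
    (d : ℕ) (hd : 2 ≤ d) (hd' : d ≤ (a + 1) * m + 1) :
    ∃ n k : ℕ, (n : ℚ) = ((q : ℚ) ^ 2 - 1) / a ∧
      (k : ℚ) = ((q : ℚ) ^ 2 - 1) / a - 2 * d + 2 ∧
      ∃ Q : Submodule ℂ (QState F n), IsQMDSCode p ζ Q k d := by
  have hchar : ringChar F ≠ 2 := by
    intro h
    have := FiniteField.even_card_of_char_two h
    rw [hF] at this
    exact absurd this (by rw [Nat.odd_iff.1 hodd]; exact one_ne_zero)
  obtain ⟨ν, hν⟩ := FiniteField.exists_nonsquare hchar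
  have : Fact (∀ r : F, r ^ 2 ≠ ν + 0 * r) :=
    ⟨fun r h => hν ⟨r, by linear_combination -h⟩⟩
  have hq1 : 1 < q := hq.one_lt
  have ha : 0 < a := by
    rcases Nat.eq_zero_or_pos a with rfl | h
    · simp at hqam
      lia
    · exact h
  have hm : 0 < m := by
    rcases Nat.eq_zero_or_pos m with rfl | h
    · simp at hqam
      lia
    · exact h
  obtain ⟨k, rfl⟩ : ∃ k, d = k + 1 := ⟨d - 1, by lia⟩
  have hk : k ≤ (a + 1) * m := by lia
  have hkn : 2 * k < 2 * m * (q + 1) := by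
    have h1 : a ≤ a * m := Nat.le_mul_of_pos_right a hm
    have h2 : m * (a + 1) < m * (q + 1) := Nat.mul_lt_mul_of_pos_left (by lia) hm
    lia
  obtain ⟨x, v, hx, hv, horth⟩ := exists_grs_multipliers (ν := ν) hodd hqam hF
  obtain ⟨Q, hQ⟩ := exists_qCode_of_grs (Ring.two_ne_zero hchar) hζ hkn hx hv
    fun i hi j hj => horth i (hi.trans_le hk) j (hj.trans_le hk)
  have hn : ((2 * m * (q + 1) : ℕ) : ℚ) = ((q : ℚ) ^ 2 - 1) / a := by
    have : (a : ℚ) ≠ 0 := by positivity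
    rw [eq_div_iff this, hqam]
    push_cast
    ring
  refine ⟨2 * m * (q + 1), 2 * m * (q + 1) - 2 * k, hn, ?_, Q, hQ, ?_⟩
  · rw [Nat.cast_sub hkn.le, hn]
    push_cast
    ring
  · rw [Nat.cast_sub hkn.le]
    push_cast
    ring
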